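/- Let $0<p<1$ and let $(\sigma_i)_{i\ge 1}$ be i.i.d. random variables with values in $\{-1,+1\}$, $P(\sigma_i=+1)=p$ and $P(\sigma_i=-1)=1-p$. Put $S_N=\sum_{i=1}^N\sigma_i\sigma_{2i}$. With $h=\tfrac12\log\frac{p}{1-p}$ and, for $\lambda\in\mathbb R$, $$\Lambda_\pm=e^{\lambda}\Big(\cosh h\pm\sqrt{\sinh^2 h+e^{-4\lambda}}\Big),\qquad v=\begin{pmatrix}e^{h/2}\\ e^{-h/2}\end{pmatrix},\qquad w_+=\begin{pmatrix}-e^{-\lambda}\\ e^{h+\lambda}-\Lambda_+\end{pmatrix},\qquad e_+=\frac{w_+}{\|w_+\|}$$ ($\Lambda_\pm$ are the eigenvalues of the one-dimensional Ising transfer matrix $M_{\alpha,\beta}=e^{\lambda\alpha\beta+\frac h2(\alpha+\beta)}$, $\alpha,\beta\in\{+1,-1\}$, and $e_+$ is a normalized eigenvector for $\Lambda_+$), define $$\mathcal F_p(\lambda)=\log\Big([p(1-p)]^{3/4}\,|v^T e_+|\,\Lambda_+\Big)+\frac12\sum_{n=1}^\infty\frac1{2^n}\log\Big(1+\Big(\frac{2\cosh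 h}{|v^T e_+|^2}-1\Big)\Big(\frac{\Lambda_-}{\Lambda_+}\Big)^n\Big).$$ Then the following hold. (a) For every $\lambda\in\mathbb R$ the series converges and $\mathcal F_p$ is the free energy of $S_N$: $\displaystyle\lim_{N\to\infty}\frac1N\log\mathbb E\big(e^{\lambda S_N}\big)=\mathcal F_p(\lambda)$. (b) The sequence $S_N/N$ satisfies the large deviation principle with speed $N$ and rate function $I_p(x)=\sup_{\lambda\in\mathbb R}\big(\lambda x-\mathcal F_p(\lambda)\big)$; that is, $I_p:\mathbb R\to[0,\infty]$ is lower semicontinuous and for every Borel set $\Gamma\subseteq\mathbb R$ $$-\inf_{x\in\mathrm{int}\,\Gamma}I_p(x)\le\liminf_{N\to\infty}\frac1N\log P\Big(\frac{S_N}N\in\Gamma\Big)\le\limsup_{N\to\infty}\frac1N\log P\Big(\frac{S_N}N\in\Gamma\Big)\le-\inf_{x\in\overline\Gamma}I_p(x).$$ (c) For $p=\tfrac12$, $\mathcal F_{1/2}(\lambda)=\log\cosh\lambda$ for all $\lambda\in\mathbb R$. -/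

import Mathlib

open MeasureTheory ProbabilityTheory Filter Topology

noncomputable section

namespace NonconventionalLDP

/-- A rate function: a lower semicontinuous function with values in `[0, ∞]`. -/
def IsRateFunction {E : Type*} [TopologicalSpace E] (I : E → EReal) : Prop :=
  LowerSemicontinuous I ∧ ∀ x, 0 ≤ I x

/-- The random variables `X N` satisfy the large deviation principle (with speed `N`) with rate
function `I`: for every Borel set `Γ`,
`-inf_{int Γ} I ≤ liminf (1/N) log P(X N ∈ Γ) ≤ limsup (1/N) log P(X N ∈ Γ) ≤ -inf_{cl Γ} I`.
Here `expGrowthInf u = liminf (log (u N) / N)` and `expGrowthSup u = limsup (log (u N) / N)`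
with values in `[-∞, ∞]` and `log 0 = -∞`. -/
def SatisfiesLDP {Ω E : Type*} [MeasurableSpace Ω] [TopologicalSpace E] [MeasurableSpace E] [BorelSpace E]
    (P : Measure Ω) (X : ℕ → Ω → E) (I : E → EReal) : Prop :=
  IsRateFunction I ∧
    ∀ Γ : Set E, MeasurableSet Γ →
      -(⨅ x ∈ interior Γ, I x) ≤ ExpGrowth.expGrowthInf (fun N => P {ω | X N ω ∈ Γ}) ∧
      ExpGrowth.expGrowthSup (fun N => P {ω | X N ω ∈ Γ}) ≤ -(⨅ x ∈ closure Γ, I x)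

/-- The Legendre transform `x ↦ sup_t (t x - F t)`, with values in `[-∞, ∞]`. -/
def legendre (F : ℝ → ℝ) (x : ℝ) : EReal :=
  ⨆ t : ℝ, ((t * x - F t : ℝ) : EReal)

/-- The sum `S_N = ∑_{i=1}^N σ_i σ_{2i}`. -/
def pairSum {Ω : Type*} (σ : ℕ → Ω → ℝ) (N : ℕ) (ω : Ω) : ℝ :=
  ∑ i ∈ Finset.Icc 1 N, σ i ω * σ (2 * i) ω

/-- The external field `h = (1/2) log (p / (1 - p))`. -/
def field (p : ℝ) : ℝ := Real.log (p / (1 - p)) / 2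

/-- The largest eigenvalue `Λ₊` of the Ising transfer matrix
`M_{α,β} = exp (t α β + (h/2) (α + β))`, `α, β ∈ {1, -1}`. -/
def eigPlus (h t : ℝ) : ℝ :=
  Real.exp t * (Real.cosh h + Real.sqrt (Real.sinh h ^ 2 + Real.exp (-4 * t)))

/-- The smallest eigenvalue `Λ₋` of the Ising transfer matrix. -/
def eigMinus (h t : ℝ) : ℝ :=
  Real.exp t * (Real.cosh h - Real.sqrt (Real.sinh h ^ 2 + Real.exp (-4 * t)))

/-- The boundary vector `v = (e^{h/2}, e^{-h/2})`. -/
def boundaryVec (h : ℝ) : EuclideanSpace ℝ (Fin 2) :=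
  !₂[Real.exp (h / 2), Real.exp (-h / 2)]

/-- The eigenvector `w₊ = (-e^{-t}, e^{h + t} - Λ₊)` for the eigenvalue `Λ₊`. -/
def eigVec (h t : ℝ) : EuclideanSpace ℝ (Fin 2) :=
  !₂[-Real.exp (-t), Real.exp (h + t) - eigPlus h t]

/-- The number `|vᵀ · e₊|`, where `e₊ = w₊ / ‖w₊‖`. -/
def overlap (h t : ℝ) : ℝ :=
  |inner ℝ (boundaryVec h) (‖eigVec h t‖⁻¹ • eigVec h t)|

/-- The term with index `n` (for `n = 1, 2, …`) of the series in the correction `G`: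
`2^{-n} log (1 + (2 cosh h / |vᵀ · e₊|² - 1) (Λ₋ / Λ₊)^n)`. -/
def corrTerm (h t : ℝ) (n : ℕ) : ℝ :=
  1 / 2 ^ n *
    Real.log (1 + (2 * Real.cosh h / overlap h t ^ 2 - 1) * (eigMinus h t / eigPlus h t) ^ n)

/-- The explicit free energy
`F_p(t) = log ([p (1 - p)]^{3/4} |vᵀ · e₊| Λ₊) + (1/2) ∑_{n ≥ 1} corrTerm n`. -/
def freeEnergy (p t : ℝ) : ℝ :=
  Real.log ((p * (1 - p)) ^ (3 / 4 : ℝ) * overlap (field p) t * eigPlus (field p) t) +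
    1 / 2 * ∑' n : ℕ, corrTerm (field p) t (n + 1)

end NonconventionalLDP

end

/-!
The bonds `(i, 2 i)` with `i ≤ N` split into the chains `r, 2 r, 4 r, …` with `r ≤ N` odd, which use
disjoint sets of spins. The chain of `r` has `L = ⌊log₂ (N / r)⌋ + 1` bonds, so
`E exp (t S_N)` is the product over `r` of the partition functions `Z_L` of one-dimensional Ising
chains with free ends (`integral_exp_pairSum`). About `N / 2 ^ (L + 1)` chains have exactly `L` bonds and
`|log Z_L| ≤ L |t|`, so dominated convergence (`tendsto_sum_numBonds`) gives the limit
`∑_{L ≥ 1} log Z_L / 2 ^ (L + 1)`, called `chainFreeEnergy`.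

To identify this limit with `freeEnergy`, the transfer matrix is diagonalized: `Z_L` satisfies the
linear recurrence given by its characteristic polynomial, and the two initial values match the
expansion in the powers of the eigenvalues (`chainPartition_eq`). Taking logarithms and summing the
arithmetic-geometric series gives the explicit formula (`hasSum_corrTerm`). For `p = 1 / 2` one has
`Z_L = cosh t ^ L`, and the series sums to `log cosh t`.

The large deviation principle is the Gärtner–Ellis theorem on the line
(`satisfiesLDP_of_differentiable`). The free energy is differentiable because the derivative of
`log Z_L` is at most `L` in absolute value, so the series can be differentiated term by term. In the lower bound, a point
where the Legendre transform is finite need not be a slope of the free energy `F`; it is approximated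
by the slopes at the maximizers of `t ↦ t x - F t - a t² / 2` as `a → 0`, along which the Legendre
transform does not exceed its value at `x` (`exists_slope_near`).
-/

namespace NonconventionalLDP

/-! ### The Gärtner–Ellis theorem on the real line -/

theorem isRateFunction_legendre {F : ℝ → ℝ} (h0 : F 0 = 0) : IsRateFunction (legendre F) := by
  refine ⟨lowerSemicontinuous_iSup fun t => Continuous.lowerSemicontinuous ?_, fun x => ?_⟩
  · exact continuous_coe_real_ereal.comp (by fun_prop)
  · refine le_iSup_of_le 0 ?_
    simp [h0]

theorem expGrowthSup_le_coe {u : ℕ → ENNReal} {c : ℝ}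
    (h : ∀ ε > 0, ∀ᶠ n : ℕ in atTop, u n ≤ ENNReal.ofReal (Real.exp (n * (c + ε)))) :
    ExpGrowth.expGrowthSup u ≤ c := by
  rw [ExpGrowth.expGrowthSup_le_iff]
  intro b hb
  obtain ⟨y, hcy, hyb⟩ := EReal.lt_iff_exists_real_btwn.1 hb
  filter_upwards [h (y - c) (sub_pos.2 (EReal.coe_lt_coe_iff.1 hcy))] with n hn
  calc u n ≤ ENNReal.ofReal (Real.exp (n * (c + (y - c)))) := hn
    _ = EReal.exp ((y : EReal) * n) := by
      rw [← EReal.exp_coe]; congr 1; push_cast [add_sub_cancel]; rw [mul_comm]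
    _ ≤ EReal.exp (b * n) := by gcongr

theorem coe_le_expGrowthInf {u : ℕ → ENNReal} {c : ℝ}
    (h : ∀ ε > 0, ∀ᶠ n : ℕ in atTop, ENNReal.ofReal (Real.exp (n * (c - ε))) ≤ u n) :
    c ≤ ExpGrowth.expGrowthInf u := by
  rw [ExpGrowth.le_expGrowthInf_iff]
  intro b hb
  obtain ⟨y, hby, hyc⟩ := EReal.lt_iff_exists_real_btwn.1 hb
  filter_upwards [h (c - y) (sub_pos.2 (EReal.coe_lt_coe_iff.1 hyc))] with n hn
  calc EReal.exp (b * n) ≤ EReal.exp ((y : EReal) * n) := by gcongr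
    _ = ENNReal.ofReal (Real.exp (n * (c - (c - y)))) := by
      rw [← EReal.exp_coe]; congr 1; rw [sub_sub_cancel, mul_comm]; simp
    _ ≤ u n := hn

theorem eventually_le_exp_of_tendsto_log {M : ℕ → ℝ} {a ε : ℝ} (hM : ∀ n, 0 < M n)
    (h : Tendsto (fun n : ℕ => 1 / (n : ℝ) * Real.log (M n)) atTop (𝓝 a)) (hε : 0 < ε) :
    ∀ᶠ n : ℕ in atTop, M n ≤ Real.exp (n * (a + ε)) ∧ Real.exp (n * (a - ε)) ≤ M n := by
  filter_upwards [h.eventually_lt_const (lt_add_of_pos_right a hε),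
    h.eventually_const_lt (sub_lt_self a hε), eventually_gt_atTop 0] with n h1 h2 hn
  have hn' : (0 : ℝ) < n := by exact_mod_cast hn
  rw [one_div, inv_mul_lt_iff₀ hn'] at h1
  rw [one_div, lt_inv_mul_iff₀ hn'] at h2
  exact ⟨(Real.log_le_iff_le_exp (hM n)).1 h1.le, (Real.le_log_iff_exp_le (hM n)).1 h2.le⟩

section GartnerEllis

variable {Ω : Type*} [MeasurableSpace Ω] {P : Measure Ω} [IsProbabilityMeasure P]
  {S : ℕ → Ω → ℝ} {F : ℝ → ℝ}

/-- Chernoff's bound on the half-line `{y | c < t y - F t}`, at exponential scale. -/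
theorem expGrowthSup_halfLine_le (hint : ∀ N t, Integrable (fun ω => Real.exp (t * S N ω)) P)
    (hlim : ∀ t, Tendsto (fun N : ℕ => 1 / (N : ℝ) * Real.log (∫ ω, Real.exp (t * S N ω) ∂P))
      atTop (𝓝 (F t))) (t c : ℝ) :
    ExpGrowth.expGrowthSup (fun N => P {ω | c < t * (S N ω / N) - F t}) ≤ ((-c : ℝ) : EReal) := by
  refine expGrowthSup_le_coe fun ε hε => ?_
  filter_upwards [eventually_le_exp_of_tendsto_log (fun N => integral_exp_pos (hint N t))
    (hlim t) hε, eventually_gt_atTop 0] with N hN hN0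
  have hN' : (0 : ℝ) < N := by exact_mod_cast hN0
  have hch := measure_ge_le_exp_mul_mgf (μ := P) (X := fun ω => t * S N ω) (t := 1)
    (N * (F t + c)) zero_le_one (by simpa using hint N t)
  rw [← ofReal_measureReal]
  refine ENNReal.ofReal_le_ofReal ?_
  calc P.real {ω | c < t * (S N ω / N) - F t}
      ≤ P.real {ω | N * (F t + c) ≤ t * S N ω} := by
        refine measureReal_mono fun ω hω => ?_
        change c < t * (S N ω / N) - F t at hω
        change N * (F t + c) ≤ t * S N ω
        rw [← mul_div_assoc, lt_sub_iff_add_lt, lt_div_iff₀ hN'] at hω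
        linarith
    _ ≤ Real.exp (-1 * (N * (F t + c))) * Real.exp (N * (F t + ε)) := by
        refine hch.trans ?_
        simp only [mgf, one_mul]
        gcongr
        exact hN.1
    _ = Real.exp (N * (-c + ε)) := by rw [← Real.exp_add]; ring_nf

/-- The upper bound of the large deviation principle. A point of the closure of `Γ` has a
neighbourhood which is a half-line as in `expGrowthSup_halfLine_le`, and finitely many of them cover
the compact set `closure Γ ∩ [-1, 1]`. -/
theorem expGrowthSup_le_neg_iInf_legendre
    (hint : ∀ N t, Integrable (fun ω => Real.exp (t * S N ω)) P)
    (hlim : ∀ t, Tendsto (fun N : ℕ => 1 / (N : ℝ) * Real.log (∫ ω, Real.exp (t * S N ω) ∂P))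
      atTop (𝓝 (F t))) (hbdd : ∀ N, ∀ᵐ ω ∂P, |S N ω| ≤ N) (Γ : Set ℝ) :
    ExpGrowth.expGrowthSup (fun N => P {ω | S N ω / N ∈ Γ}) ≤
      -(⨅ x ∈ closure Γ, legendre F x) := by
  by_contra! hlt
  obtain ⟨z, hz1, hz2⟩ := EReal.lt_iff_exists_real_btwn.1 hlt
  refine hz2.not_ge ?_
  have hK : IsCompact (closure Γ ∩ Set.Icc (-1) 1) := isCompact_Icc.inter_left isClosed_closure
  have key : ExpGrowth.expGrowthSup
      (fun N => P {ω | S N ω / N ∈ closure Γ ∩ Set.Icc (-1) 1}) ≤ z := by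
    refine hK.induction_on
      (p := fun A => ExpGrowth.expGrowthSup (fun N => P {ω | S N ω / N ∈ A}) ≤ z) ?_ ?_ ?_ ?_
    · have : (fun N => P {ω | S N ω / N ∈ (∅ : Set ℝ)}) = 0 := by
        funext N
        simp
      rw [this, ExpGrowth.expGrowthSup_zero]
      exact bot_le
    · intro A B hAB hB
      have hle : (fun N => P {ω | S N ω / N ∈ A}) ≤ fun N => P {ω | S N ω / N ∈ B} :=
        fun N => measure_mono (s := {ω | S N ω / N ∈ A}) fun ω hω => hAB hω
      exact (ExpGrowth.expGrowthSup_monotone hle).trans hB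
    · intro A B hA hB
      have hle : (fun N => P {ω | S N ω / N ∈ A ∪ B}) ≤
          (fun N => P {ω | S N ω / N ∈ A}) + fun N => P {ω | S N ω / N ∈ B} :=
        fun N => measure_union_le {ω | S N ω / N ∈ A} {ω | S N ω / N ∈ B}
      refine (ExpGrowth.expGrowthSup_monotone hle).trans ?_
      rw [ExpGrowth.expGrowthSup_add]
      exact sup_le hA hB
    · intro x hx
      have hx' : ((-z : ℝ) : EReal) < legendre F x := by
        rw [EReal.neg_lt_comm] at hz1
        push_cast
        exact hz1.trans_le (iInf₂_le x hx.1)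
      obtain ⟨t, ht⟩ := lt_iSup_iff.1 hx'
      rw [EReal.coe_lt_coe_iff] at ht
      refine ⟨{y | -z < t * y - F t}, mem_nhdsWithin_of_mem_nhds
        ((isOpen_lt continuous_const (by fun_prop)).mem_nhds ht), ?_⟩
      simpa using expGrowthSup_halfLine_le hint hlim t (-z)
  have hle : (fun N => P {ω | S N ω / N ∈ Γ}) ≤
      fun N => P {ω | S N ω / N ∈ closure Γ ∩ Set.Icc (-1) 1} := by
    intro N
    refine measure_mono_ae (s := {ω | S N ω / N ∈ Γ}) ?_
    filter_upwards [hbdd N] with ω hω hΓ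
    refine ⟨subset_closure hΓ, abs_le.1 ?_⟩
    rw [abs_div, Nat.abs_cast]
    exact div_le_one_of_le₀ hω N.cast_nonneg
  exact (ExpGrowth.expGrowthSup_monotone hle).trans key

/-- The lower bound near a point `d` which is the slope of `F` at `t`: under the measures tilted by
`exp (t * S N)`, the variables `S N / N` concentrate at `d`. -/
theorem eventually_exp_le_measure_near_slope
    (hint : ∀ N t, Integrable (fun ω => Real.exp (t * S N ω)) P) (hmeas : ∀ N, Measurable (S N))
    (hlim : ∀ t, Tendsto (fun N : ℕ => 1 / (N : ℝ) * Real.log (∫ ω, Real.exp (t * S N ω) ∂P))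
      atTop (𝓝 (F t))) {t d δ ε : ℝ} (hd : HasDerivAt F d t) (hδ : 0 < δ) (hε : 0 < ε) :
    ∀ᶠ N : ℕ in atTop,
      Real.exp (N * (-(t * d - F t) - ε)) ≤ P.real {ω | |S N ω / N - d| < δ} := by
  obtain ⟨δ', hδ'0, hδ'δ, hδ't⟩ : ∃ δ' > 0, δ' ≤ δ ∧ |t| * δ' ≤ ε / 2 := by
    refine ⟨min δ (ε / (2 * (|t| + 1))), by positivity, min_le_left _ _, ?_⟩
    calc |t| * min δ (ε / (2 * (|t| + 1))) ≤ (|t| + 1) * (ε / (2 * (|t| + 1))) := by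
          gcongr
          · linarith
          · exact min_le_right _ _
      _ = ε / 2 := by field_simp
  -- a step `s` at which the secants of `F` at `t` have slopes close to `d`
  obtain ⟨s, hs0, hs1, hs2⟩ : ∃ s > 0, F (t + s) ≤ F t + s * (d + δ' / 2) ∧
      F (t - s) ≤ F t - s * (d - δ' / 2) := by
    have hlo := (hasDerivAt_iff_isLittleO_nhds_zero.1 hd).def (half_pos hδ'0)
    obtain ⟨r, hr, hball⟩ := Metric.eventually_nhds_iff.1 hlo
    have h1 := hball (y := r / 2) (by rw [Real.dist_eq, sub_zero, abs_of_pos] <;> linarith)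
    have h2 := hball (y := -(r / 2)) (by rw [Real.dist_eq, sub_zero, abs_neg, abs_of_pos] <;> linarith)
    simp only [smul_eq_mul, Real.norm_eq_abs, abs_neg, abs_of_pos (half_pos hr)] at h1 h2
    have h3 := (abs_le.1 h1).2
    have h4 := (abs_le.1 h2).2
    refine ⟨r / 2, half_pos hr, by linarith, ?_⟩
    rw [sub_eq_add_neg t]
    linarith
  -- the tilts by `± s` cost at least `s δ' / 2 ≥ 4 η` in the exponent, which dominates the errors `η`
  -- in the three exponential moments
  set η := min (s * δ' / 8) (ε / 4) with hη
  have hη0 : 0 < η := by positivity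
  have hη1 : 8 * η ≤ s * δ' := by linarith [min_le_left (s * δ' / 8) (ε / 4)]
  have hη2 : 4 * η ≤ ε := by linarith [min_le_right (s * δ' / 8) (ε / 4)]
  have hpos : ∀ u N, 0 < ∫ ω, Real.exp (u * S N ω) ∂P := fun u N => integral_exp_pos (hint N u)
  have hsmall : ∀ᶠ N : ℕ in atTop, Real.exp (N * (-η)) < 1 / 4 := by
    have : Tendsto (fun N : ℕ => Real.exp (N * (-η))) atTop (𝓝 0) :=
      Real.tendsto_exp_atBot.comp
        (tendsto_natCast_atTop_atTop.atTop_mul_const_of_neg (neg_lt_zero.2 hη0))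
    exact this.eventually_lt_const (by norm_num)
  filter_upwards [eventually_le_exp_of_tendsto_log (hpos t) (hlim t) hη0,
    eventually_le_exp_of_tendsto_log (hpos (t + s)) (hlim (t + s)) hη0,
    eventually_le_exp_of_tendsto_log (hpos (t - s)) (hlim (t - s)) hη0,
    hsmall, eventually_gt_atTop 0] with N hM hMp hMm hsm hN0
  have hN : (0 : ℝ) < N := by exact_mod_cast hN0
  set A : Set Ω := {ω | |S N ω / N - d| < δ'} with hA
  have hAm : MeasurableSet A :=
    measurableSet_lt ((((hmeas N).div_const _).sub_const _).abs) measurable_const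
  -- off `A`, one of the two tilts by `± s` dominates
  have hpt : ∀ ω, Real.exp (t * S N ω) ≤
      A.indicator (fun _ => Real.exp (N * (t * d + |t| * δ'))) ω +
      Real.exp (-(N * (s * (d + δ')))) * Real.exp ((t + s) * S N ω) +
      Real.exp (N * (s * (d - δ'))) * Real.exp ((t - s) * S N ω) := by
    intro ω
    set y := S N ω / N with hy
    have hSy : S N ω = N * y := by rw [hy]; field_simp
    rw [hSy, ← Real.exp_add, ← Real.exp_add]
    have e1 := Real.exp_pos (-(N * (s * (d + δ'))) + (t + s) * (N * y))
    have e2 := Real.exp_pos (N * (s * (d - δ')) + (t - s) * (N * y))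
    have e0 : 0 ≤ A.indicator (fun _ => Real.exp (N * (t * d + |t| * δ'))) ω :=
      Set.indicator_nonneg (fun _ _ => (Real.exp_pos _).le) _
    by_cases hω : ω ∈ A
    · have h1 : |y - d| < δ' := hω
      have h2 : t * (y - d) ≤ |t| * δ' :=
        (le_abs_self _).trans (by rw [abs_mul]; gcongr)
      rw [Set.indicator_of_mem hω]
      have h3 : Real.exp (t * (N * y)) ≤ Real.exp (N * (t * d + |t| * δ')) := by
        refine Real.exp_le_exp.2 ?_
        calc t * (N * y) = N * (t * d + t * (y - d)) := by ring
          _ ≤ _ := by gcongr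
      linarith
    · have h1 : δ' ≤ |y - d| := not_lt.1 hω
      rcases le_abs.1 h1 with h | h
      · have h3 : Real.exp (t * (N * y)) ≤
            Real.exp (-(N * (s * (d + δ'))) + (t + s) * (N * y)) := by
          refine Real.exp_le_exp.2 ?_
          have : 0 ≤ N * (s * (y - d - δ')) := by
            have : 0 ≤ y - d - δ' := by linarith
            positivity
          linarith
        linarith
      · have h3 : Real.exp (t * (N * y)) ≤ Real.exp (N * (s * (d - δ')) + (t - s) * (N * y)) := by
          refine Real.exp_le_exp.2 ?_
          have : 0 ≤ N * (s * (d - δ' - y)) := by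
            have : 0 ≤ d - δ' - y := by linarith
            positivity
          linarith
        linarith
  have hI0 : Integrable (A.indicator fun _ => Real.exp (N * (t * d + |t| * δ'))) P :=
    (integrable_const _).indicator hAm
  have hI1 := (hint N (t + s)).const_mul (Real.exp (-(N * (s * (d + δ')))))
  have hI2 := (hint N (t - s)).const_mul (Real.exp (N * (s * (d - δ'))))
  have hmain := integral_mono (hint N t) ((hI0.add hI1).add hI2) hpt
  rw [integral_add' (hI0.add hI1) hI2, integral_add' hI0 hI1, integral_indicator_const _ hAm,
    integral_const_mul, integral_const_mul, smul_eq_mul] at hmain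
  have hp : Real.exp (-(N * (s * (d + δ')))) * ∫ ω, Real.exp ((t + s) * S N ω) ∂P ≤
      Real.exp (N * (F t - η)) * (1 / 4) := by
    calc _ ≤ Real.exp (-(N * (s * (d + δ')))) * Real.exp (N * (F (t + s) + η)) := by
          gcongr; exact hMp.1
      _ ≤ Real.exp (N * (F t - η)) * Real.exp (N * (-η)) := by
          rw [← Real.exp_add, ← Real.exp_add]
          refine Real.exp_le_exp.2 ?_
          have : 0 ≤ N * (F t - 2 * η + s * (d + δ') - F (t + s) - η) :=
            mul_nonneg hN.le (by linarith)
          linarith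
      _ ≤ _ := by gcongr
  have hm : Real.exp (N * (s * (d - δ'))) * ∫ ω, Real.exp ((t - s) * S N ω) ∂P ≤
      Real.exp (N * (F t - η)) * (1 / 4) := by
    calc _ ≤ Real.exp (N * (s * (d - δ'))) * Real.exp (N * (F (t - s) + η)) := by
          gcongr; exact hMm.1
      _ ≤ Real.exp (N * (F t - η)) * Real.exp (N * (-η)) := by
          rw [← Real.exp_add, ← Real.exp_add]
          refine Real.exp_le_exp.2 ?_
          have : 0 ≤ N * (F t - 2 * η - s * (d - δ') - F (t - s) - η) :=
            mul_nonneg hN.le (by linarith)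
          linarith
      _ ≤ _ := by gcongr
  have hAbig : Real.exp (N * (F t - η)) * (1 / 4) ≤
      P.real A * Real.exp (N * (t * d + |t| * δ')) := by
    have h1 := hM.2.trans hmain
    have h2 := Real.exp_pos (N * (F t - η))
    linarith
  have hAδ : P.real A ≤ P.real {ω | |S N ω / N - d| < δ} :=
    measureReal_mono fun ω hω => lt_of_lt_of_le hω hδ'δ
  refine le_trans ?_ hAδ
  rw [← div_le_iff₀ (Real.exp_pos _)] at hAbig
  refine le_trans ?_ hAbig
  rw [le_div_iff₀ (Real.exp_pos _)]
  calc _ ≤ Real.exp (N * (F t - η)) * Real.exp (N * (-η)) := by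
        rw [← Real.exp_add, ← Real.exp_add]
        refine Real.exp_le_exp.2 ?_
        have : 0 ≤ N * (ε - |t| * δ' - 2 * η) := mul_nonneg hN.le (by linarith)
        linarith
    _ ≤ _ := by gcongr

/-- A point `x` where the Legendre transform of `F` is at most `K` is a limit of slopes `d` of `F`
where the Legendre transform is also at most `K`. The slopes come from the maximizers of
`t ↦ t x - F t - a t² / 2`. -/
theorem exists_slope_near {F F' : ℝ → ℝ} (hF : ∀ t, HasDerivAt F (F' t) t) (h0 : F 0 = 0)
    {x K δ : ℝ} (hK : ∀ t, t * x - F t ≤ K) (hδ : 0 < δ) :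
    ∃ t, |F' t - x| < δ ∧ t * F' t - F t ≤ K := by
  have hK0 : 0 ≤ K := by simpa [h0] using hK 0
  -- the maximizer `t` satisfies `a t² ≤ 2 K`, and `a` makes the distance `a |t|` less than `δ`
  set a := δ ^ 2 / (2 * (K + 1)) with ha
  have ha0 : 0 < a := by positivity
  set g : ℝ → ℝ := fun t => t * x - F t - a * t ^ 2 / 2 with hg
  have hgd : ∀ t, HasDerivAt g (x - F' t - a * t) t := by
    intro t
    have h1 := ((hasDerivAt_id t).mul_const x).sub (hF t)
    have h2 := (((hasDerivAt_id t).pow 2).const_mul a).div_const 2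
    convert! h1.sub h2 using 1
    simp
    ring
  have hgc : Continuous g := continuous_iff_continuousAt.2 fun t => (hgd t).continuousAt
  have hlim : Tendsto g (cocompact ℝ) atBot := by
    have h1 : Tendsto (fun t : ℝ => K - a / 2 * ‖t‖ ^ 2) (cocompact ℝ) atBot := by
      refine tendsto_atBot_add_const_left _ K (tendsto_neg_atTop_atBot.comp ?_)
      exact ((tendsto_pow_atTop two_ne_zero).comp tendsto_norm_cocompact_atTop).const_mul_atTop
        (half_pos ha0)
    refine tendsto_atBot_mono (fun t => ?_) h1
    simp only [hg, Real.norm_eq_abs, sq_abs]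
    linarith [hK t]
  obtain ⟨t, ht⟩ := hgc.exists_forall_ge hlim
  have hcrit : x - F' t - a * t = 0 :=
    IsLocalMax.hasDerivAt_eq_zero (Eventually.of_forall ht) (hgd t)
  have hgt : 0 ≤ t * x - F t - a * t ^ 2 / 2 := by simpa [hg, h0] using ht 0
  have hKt := hK t
  have hat : 0 ≤ a * t ^ 2 := by positivity
  refine ⟨t, abs_lt_of_sq_lt_sq ?_ hδ.le, ?_⟩
  · have h1 : F' t - x = -(a * t) := by linarith
    have h2 : a * (K + 1) = δ ^ 2 / 2 := by rw [ha]; field_simp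
    calc (F' t - x) ^ 2 = a * (a * t ^ 2) := by rw [h1]; ring
      _ ≤ a * (2 * K) := mul_le_mul_of_nonneg_left (by linarith) ha0.le
      _ < δ ^ 2 := by linarith
  · have h1 : F' t = x - a * t := by linarith
    rw [h1]
    linarith

/-- The lower bound of the large deviation principle. -/
theorem neg_iInf_legendre_le_expGrowthInf
    (hint : ∀ N t, Integrable (fun ω => Real.exp (t * S N ω)) P) (hmeas : ∀ N, Measurable (S N))
    (hlim : ∀ t, Tendsto (fun N : ℕ => 1 / (N : ℝ) * Real.log (∫ ω, Real.exp (t * S N ω) ∂P))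
      atTop (𝓝 (F t))) (hF : Differentiable ℝ F) (h0 : F 0 = 0) (Γ : Set ℝ) :
    -(⨅ x ∈ interior Γ, legendre F x) ≤
      ExpGrowth.expGrowthInf (fun N => P {ω | S N ω / N ∈ Γ}) := by
  rw [EReal.neg_le]
  refine le_iInf₂ fun x hx => ?_
  rw [EReal.neg_le]
  have hnonneg := (isRateFunction_legendre h0).2 x
  induction hI : legendre F x with
  | bot => simp [hI] at hnonneg
  | top => simp
  | coe K =>
    obtain ⟨δ, hδ, hball⟩ := Metric.isOpen_iff.1 isOpen_interior x hx
    have hK : ∀ t, t * x - F t ≤ K := fun t => by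
      rw [← EReal.coe_le_coe_iff, ← hI]
      exact le_iSup (fun t => ((t * x - F t : ℝ) : EReal)) t
    obtain ⟨t, htx, htK⟩ := exists_slope_near (fun t => (hF t).hasDerivAt) h0 hK (half_pos hδ)
    rw [← EReal.coe_neg]
    refine coe_le_expGrowthInf fun ε hε => ?_
    filter_upwards [eventually_exp_le_measure_near_slope hint hmeas hlim (hF t).hasDerivAt
      (half_pos hδ) hε] with N hN
    rw [← ofReal_measureReal]
    refine ENNReal.ofReal_le_ofReal (le_trans ?_ (hN.trans (measureReal_mono fun ω hω => ?_)))
    · gcongr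
    · refine interior_subset (s := Γ) (hball ?_)
      rw [Metric.mem_ball, Real.dist_eq]
      have hω' : |S N ω / N - deriv F t| < δ / 2 := hω
      rw [abs_lt] at *
      constructor <;> linarith

/-- The Gärtner–Ellis theorem for real variables `S N / N` with values in `[-1, 1]`. -/
theorem satisfiesLDP_of_differentiable
    (hint : ∀ N t, Integrable (fun ω => Real.exp (t * S N ω)) P) (hmeas : ∀ N, Measurable (S N))
    (hlim : ∀ t, Tendsto (fun N : ℕ => 1 / (N : ℝ) * Real.log (∫ ω, Real.exp (t * S N ω) ∂P))
      atTop (𝓝 (F t))) (hbdd : ∀ N, ∀ᵐ ω ∂P, |S N ω| ≤ N)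
    (hF : Differentiable ℝ F) (h0 : F 0 = 0) :
    SatisfiesLDP P (fun N ω => S N ω / N) (legendre F) :=
  ⟨isRateFunction_legendre h0, fun Γ _ =>
    ⟨neg_iInf_legendre_le_expGrowthInf hint hmeas hlim hF h0 Γ,
      expGrowthSup_le_neg_iInf_legendre hint hlim hbdd Γ⟩⟩

end GartnerEllis

/-! ### Partition functions of finite chains -/

/-- The exponential moment `E exp (t ∑_{j < L} τ_j τ_{j+1})` of an i.i.d. chain `τ_0, …, τ_L`,
restricted to the events `τ_L = 1` (first component) and `τ_L = -1` (second component). -/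
noncomputable def chainWeight (p t : ℝ) : ℕ → ℝ × ℝ
  | 0 => (p, 1 - p)
  | L + 1 =>
    (p * (Real.exp t * (chainWeight p t L).1 + Real.exp (-t) * (chainWeight p t L).2),
      (1 - p) * (Real.exp (-t) * (chainWeight p t L).1 + Real.exp t * (chainWeight p t L).2))

/-- The partition function `E exp (t ∑_{j < L} τ_j τ_{j+1})` of an i.i.d. chain `τ_0, …, τ_L`, so
that `L` counts the bonds of the chain and not its spins. -/
noncomputable def chainPartition (p t : ℝ) (L : ℕ) : ℝ :=
  (chainWeight p t L).1 + (chainWeight p t L).2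

theorem chainWeight_pos {p : ℝ} (hp0 : 0 < p) (hp1 : p < 1) (t : ℝ) (L : ℕ) :
    0 < (chainWeight p t L).1 ∧ 0 < (chainWeight p t L).2 := by
  have hq : 0 < 1 - p := sub_pos.2 hp1
  induction L with
  | zero => exact ⟨hp0, hq⟩
  | succ L ih =>
    obtain ⟨h1, h2⟩ := ih
    constructor <;> simp only [chainWeight] <;> positivity

theorem chainPartition_pos {p : ℝ} (hp0 : 0 < p) (hp1 : p < 1) (t : ℝ) (L : ℕ) :
    0 < chainPartition p t L :=
  add_pos (chainWeight_pos hp0 hp1 t L).1 (chainWeight_pos hp0 hp1 t L).2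

theorem chainPartition_zero_right (p t : ℝ) : chainPartition p t 0 = 1 := by
  simp [chainPartition, chainWeight]

theorem chainPartition_zero_left (p : ℝ) (L : ℕ) : chainPartition p 0 L = 1 := by
  induction L with
  | zero => exact chainPartition_zero_right p 0
  | succ L ih =>
    simp only [chainPartition, chainWeight, neg_zero, Real.exp_zero, one_mul] at ih ⊢
    rw [ih]
    ring

theorem chainPartition_half (t : ℝ) (L : ℕ) : chainPartition (1 / 2) t L = Real.cosh t ^ L := by
  have h : chainWeight (1 / 2) t L = (Real.cosh t ^ L / 2, Real.cosh t ^ L / 2) := by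
    induction L with
    | zero => norm_num [chainWeight]
    | succ L ih =>
      rw [chainWeight, ih, pow_succ, Real.cosh_eq]
      ext <;> ring
  rw [chainPartition, h, add_halves]

/-- The logarithmic derivative in `t` of the weights of a chain with `L` bonds is at most `L` in
absolute value, being a mean of the energy `∑_{j < L} τ_j τ_{j+1}`. -/
theorem exists_hasDerivAt_chainWeight {p : ℝ} (hp0 : 0 < p) (hp1 : p < 1) (t : ℝ) (L : ℕ) :
    ∃ a b : ℝ, HasDerivAt (fun s => (chainWeight p s L).1) a t ∧
      HasDerivAt (fun s => (chainWeight p s L).2) b t ∧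
      |a| ≤ L * (chainWeight p t L).1 ∧ |b| ≤ L * (chainWeight p t L).2 := by
  have hq : 0 < 1 - p := sub_pos.2 hp1
  induction L with
  | zero => exact ⟨0, 0, hasDerivAt_const _ _, hasDerivAt_const _ _, by simp, by simp⟩
  | succ L ih =>
    obtain ⟨a, b, ha, hb, ha', hb'⟩ := ih
    have hw := chainWeight_pos hp0 hp1 t L
    have he : HasDerivAt (fun s : ℝ => Real.exp s) (Real.exp t) t := Real.hasDerivAt_exp t
    have hn : HasDerivAt (fun s : ℝ => Real.exp (-s)) (-Real.exp (-t)) t := by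
      simpa using (hasDerivAt_neg t).exp
    refine ⟨_, _, ((he.mul ha).add (hn.mul hb)).const_mul p,
      ((hn.mul ha).add (he.mul hb)).const_mul (1 - p), ?_, ?_⟩
    all_goals
      simp only [chainWeight]
      set w := (chainWeight p t L).1
      set z := (chainWeight p t L).2
      have e1 := Real.exp_pos t
      have e2 := Real.exp_pos (-t)
      set E := Real.exp t
      set m := Real.exp (-t)
      rw [abs_le] at ha' hb'
      rw [abs_mul]
      push_cast
      have h1 := mul_le_mul_of_nonneg_left ha'.1 e1.le
      have h2 := mul_le_mul_of_nonneg_left ha'.2 e1.le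
      have h3 := mul_le_mul_of_nonneg_left hb'.1 e2.le
      have h4 := mul_le_mul_of_nonneg_left hb'.2 e2.le
      have h5 := mul_le_mul_of_nonneg_left ha'.1 e2.le
      have h6 := mul_le_mul_of_nonneg_left ha'.2 e2.le
      have h7 := mul_le_mul_of_nonneg_left hb'.1 e1.le
      have h8 := mul_le_mul_of_nonneg_left hb'.2 e1.le
      have g1 := mul_pos e1 hw.1
      have g2 := mul_pos e2 hw.2
      have g3 := mul_pos e2 hw.1
      have g4 := mul_pos e1 hw.2
      rw [mul_left_comm]
    · rw [abs_of_pos hp0]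
      refine mul_le_mul_of_nonneg_left (abs_le.2 ⟨?_, ?_⟩) hp0.le <;> linarith
    · rw [abs_of_pos hq]
      refine mul_le_mul_of_nonneg_left (abs_le.2 ⟨?_, ?_⟩) hq.le <;> linarith

theorem exists_hasDerivAt_log_chainPartition {p : ℝ} (hp0 : 0 < p) (hp1 : p < 1) (L : ℕ) (t : ℝ) :
    ∃ d : ℝ, HasDerivAt (fun s => Real.log (chainPartition p s L)) d t ∧ |d| ≤ L := by
  obtain ⟨a, b, ha, hb, ha', hb'⟩ := exists_hasDerivAt_chainWeight hp0 hp1 t L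
  have hpos := chainPartition_pos hp0 hp1 t L
  refine ⟨_, (ha.add hb).log hpos.ne', ?_⟩
  change |(a + b) / chainPartition p t L| ≤ L
  rw [abs_div, abs_of_pos hpos, div_le_iff₀ hpos]
  refine (abs_add_le a b).trans ((add_le_add ha' hb').trans_eq ?_)
  rw [chainPartition, mul_add]

theorem abs_log_chainPartition_le {p : ℝ} (hp0 : 0 < p) (hp1 : p < 1) (t : ℝ) (L : ℕ) :
    |Real.log (chainPartition p t L)| ≤ L * |t| := by
  choose d hd hd' using exists_hasDerivAt_log_chainPartition hp0 hp1 L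
  simpa [chainPartition_zero_left] using
    convex_univ.norm_image_sub_le_of_norm_hasDerivWithin_le (C := L)
      (fun s _ => (hd s).hasDerivWithinAt) (fun s _ => hd' s) (Set.mem_univ 0) (Set.mem_univ t)

theorem hasSum_one_div_two_pow_succ : HasSum (fun n : ℕ => (1 : ℝ) / 2 ^ (n + 1)) 1 := by
  convert! hasSum_geometric_two' (1 : ℝ) using 2 with n
  rw [pow_succ]
  field_simp

theorem hasSum_succ_div_two_pow_succ :
    HasSum (fun n : ℕ => ((n + 1 : ℕ) : ℝ) / 2 ^ (n + 1)) 2 := by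
  have h := hasSum_coe_mul_geometric_of_norm_lt_one (r := (1 / 2 : ℝ)) (by norm_num)
  rw [← hasSum_nat_add_iff' 1] at h
  convert! h using 2
  · rw [one_div, inv_pow, div_eq_mul_inv]
  · norm_num

/-- The free energy per site as a mixture of chains: among the maximal chains `r, 2 r, 4 r, …` with
`r` odd, there are asymptotically `N / 2 ^ (L + 1)` with exactly `L ≥ 1` bonds. -/
noncomputable def chainFreeEnergy (p t : ℝ) : ℝ :=
  ∑' n : ℕ, Real.log (chainPartition p t (n + 1)) / 2 ^ (n + 2)

theorem summable_log_chainPartition {p : ℝ} (hp0 : 0 < p) (hp1 : p < 1) (t : ℝ) :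
    Summable fun n : ℕ => Real.log (chainPartition p t (n + 1)) / 2 ^ (n + 2) := by
  refine Summable.of_norm_bounded (hasSum_succ_div_two_pow_succ.summable.mul_left |t|) fun n => ?_
  rw [norm_div, Real.norm_eq_abs, Real.norm_of_nonneg (by positivity), mul_div_assoc']
  refine div_le_div₀ (by positivity) ?_ (by positivity)
    (pow_le_pow_right₀ one_le_two (by omega))
  rw [mul_comm |t|]
  exact abs_log_chainPartition_le hp0 hp1 t (n + 1)

theorem differentiable_chainFreeEnergy {p : ℝ} (hp0 : 0 < p) (hp1 : p < 1) :
    Differentiable ℝ (chainFreeEnergy p) := by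
  intro t
  choose d hd hd' using fun n : ℕ => exists_hasDerivAt_log_chainPartition hp0 hp1 (n + 1)
  refine HasDerivAt.differentiableAt (f' := ∑' n : ℕ, d n t / 2 ^ (n + 2)) ?_
  refine hasDerivAt_tsum_of_isPreconnected hasSum_succ_div_two_pow_succ.summable isOpen_univ
    isPreconnected_univ (fun n s _ => (hd n s).div_const _) (fun n s _ => ?_) (Set.mem_univ t)
    (summable_log_chainPartition hp0 hp1 t) (Set.mem_univ t)
  rw [norm_div, Real.norm_eq_abs, Real.norm_of_nonneg (by positivity)]
  exact div_le_div₀ (by positivity) (hd' n s) (by positivity)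
    (pow_le_pow_right₀ one_le_two (by omega))

theorem chainFreeEnergy_zero (p : ℝ) : chainFreeEnergy p 0 = 0 := by
  simp [chainFreeEnergy, chainPartition_zero_left]

theorem chainFreeEnergy_half (t : ℝ) : chainFreeEnergy (1 / 2) t = Real.log (Real.cosh t) := by
  have h := hasSum_succ_div_two_pow_succ.mul_left (Real.log (Real.cosh t) / 2)
  rw [div_mul_cancel₀ _ two_ne_zero] at h
  rw [chainFreeEnergy, ← h.tsum_eq]
  refine tsum_congr fun n => ?_
  rw [chainPartition_half, Real.log_pow, pow_succ _ (n + 1)]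
  field_simp

/-! ### Diagonalization of the transfer matrix -/

theorem eigMinus_eq (h t : ℝ) : eigMinus h t = 2 * Real.exp t * Real.cosh h - eigPlus h t := by
  rw [eigMinus, eigPlus]
  ring

/-- The characteristic equation of the transfer matrix, with the diagonal entries
`exp (h + t)` and `exp (t - h)`. -/
theorem eigPlus_sub_mul_eigPlus_sub (h t : ℝ) :
    (eigPlus h t - Real.exp (h + t)) * (eigPlus h t - Real.exp (t - h)) = Real.exp (-t) ^ 2 := by
  have hs := Real.sq_sqrt (x := Real.sinh h ^ 2 + Real.exp (-4 * t)) (by positivity)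
  have h1 : Real.exp (-4 * t) = Real.exp (-t) ^ 4 := by rw [← Real.exp_nat_mul]; ring_nf
  have h2 : Real.exp t * Real.exp (-t) = 1 := by rw [← Real.exp_add]; simp
  have h3 : Real.exp (h + t) = Real.exp t * (Real.cosh h + Real.sinh h) := by
    rw [Real.exp_add, Real.cosh_add_sinh, mul_comm]
  have h4 : Real.exp (t - h) = Real.exp t * (Real.cosh h - Real.sinh h) := by
    rw [sub_eq_add_neg, Real.exp_add, Real.cosh_sub_sinh]
  rw [eigPlus, h3, h4]
  set s := Real.sqrt (Real.sinh h ^ 2 + Real.exp (-4 * t))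
  rw [h1] at hs
  calc _ = Real.exp t ^ 2 * (s ^ 2 - Real.sinh h ^ 2) := by ring
    _ = (Real.exp t * Real.exp (-t)) ^ 2 * Real.exp (-t) ^ 2 := by rw [hs]; ring
    _ = _ := by rw [h2]; ring

theorem exp_add_lt_eigPlus (h t : ℝ) : Real.exp (h + t) < eigPlus h t := by
  have h3 : Real.exp (h + t) = Real.exp t * (Real.cosh h + Real.sinh h) := by
    rw [Real.exp_add, Real.cosh_add_sinh, mul_comm]
  rw [h3, eigPlus]
  gcongr
  refine Real.lt_sqrt_of_sq_lt ?_
  linarith [Real.exp_pos (-4 * t)]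

theorem eigPlus_pos (h t : ℝ) : 0 < eigPlus h t :=
  (Real.exp_pos _).trans (exp_add_lt_eigPlus h t)

theorem overlap_sq (h t : ℝ) :
    overlap h t ^ 2 =
      (Real.exp (h / 2) * Real.exp (-t) + Real.exp (-h / 2) * (eigPlus h t - Real.exp (h + t))) ^ 2 /
        (Real.exp (-t) ^ 2 + (eigPlus h t - Real.exp (h + t)) ^ 2) := by
  have hn : ‖eigVec h t‖ ^ 2 =
      Real.exp (-t) ^ 2 + (eigPlus h t - Real.exp (h + t)) ^ 2 := by
    rw [EuclideanSpace.norm_sq_eq]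
    simp [eigVec]
    ring
  rw [overlap, sq_abs, inner_smul_right, mul_pow, inv_pow, hn, mul_comm, ← div_eq_mul_inv]
  congr 1
  simp [boundaryVec, eigVec, PiLp.inner_apply]
  ring

theorem overlap_pos (h t : ℝ) : 0 < overlap h t := by
  have h1 := sub_pos.2 (exp_add_lt_eigPlus h t)
  have h2 : 0 < overlap h t ^ 2 := by
    rw [overlap_sq]
    positivity
  exact (abs_nonneg _).lt_of_ne' (fun h0 => by rw [overlap, h0] at h2; norm_num at h2)

/-- The quadratic form of the transfer matrix at the boundary vector, in its eigenbasis. The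
component of the boundary vector along the second eigenvector has squared norm
`2 cosh h - overlap ^ 2`. -/
theorem eigPlus_mul_overlap_sq_add (h t : ℝ) :
    eigPlus h t * overlap h t ^ 2 + eigMinus h t * (2 * Real.cosh h - overlap h t ^ 2) =
      Real.exp h * Real.exp (h + t) + 2 * Real.exp (-t) + Real.exp (-h) * Real.exp (t - h) := by
  have hx : Real.exp h = Real.exp (h / 2) ^ 2 := by rw [← Real.exp_nat_mul]; ring_nf
  have hy : Real.exp (-h) = Real.exp (-h / 2) ^ 2 := by rw [← Real.exp_nat_mul]; ring_nf
  have hxy : Real.exp (h / 2) * Real.exp (-h / 2) = 1 := by rw [← Real.exp_add]; ring_nf; simp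
  have hsum : 2 * Real.exp t * Real.cosh h = Real.exp (h + t) + Real.exp (t - h) := by
    rw [Real.cosh_eq, Real.exp_add, sub_eq_add_neg, Real.exp_add]; ring
  have hcosh : 2 * Real.cosh h = Real.exp (h / 2) ^ 2 + Real.exp (-h / 2) ^ 2 := by
    rw [Real.cosh_eq, hx, hy]; ring
  have hchar := eigPlus_sub_mul_eigPlus_sub h t
  have hα := sub_pos.2 (exp_add_lt_eigPlus h t)
  rw [eigMinus_eq, hsum, hcosh, overlap_sq, hx, hy]
  have hm := Real.exp_pos (-t)
  generalize Real.exp (h / 2) = x at *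
  generalize Real.exp (-h / 2) = y at *
  generalize Real.exp (-t) = m at *
  generalize Real.exp (h + t) = A at *
  generalize Real.exp (t - h) = D at *
  generalize eigPlus h t = Λ at *
  obtain ⟨α, rfl⟩ : ∃ α, Λ = A + α := ⟨Λ - A, by ring⟩
  obtain ⟨δ, rfl⟩ : ∃ δ, D = A + α - δ := ⟨A + α - D, by ring⟩
  have hα' : 0 < α := by linarith
  -- `α = Λ₊ - A` and `δ = Λ₊ - D` for the diagonal entries `A`, `D`, so that `Λ₊ - Λ₋ = α + δ`
  have hq : (α + δ) * ((x * m + y * α) ^ 2 / (m ^ 2 + α ^ 2)) = δ * x ^ 2 + 2 * m + α * y ^ 2 := by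
    rw [mul_div_assoc', div_eq_iff (by positivity)]
    linear_combination (-(α * x ^ 2 - 2 * x * y * m - α * y ^ 2)) * hchar +
      (m ^ 2 + α ^ 2) * 2 * m * hxy
  rw [add_sub_cancel_left]
  linear_combination hq

theorem sqrt_mul_exp_field {p : ℝ} (hp0 : 0 < p) (hp1 : p < 1) :
    √(p * (1 - p)) * Real.exp (field p) = p ∧ √(p * (1 - p)) * Real.exp (-field p) = 1 - p := by
  have hq : 0 < 1 - p := sub_pos.2 hp1
  have hκ := Real.sq_sqrt (mul_pos hp0 hq).le
  have h1 : √(p * (1 - p)) * Real.exp (field p) = p := by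
    rw [← sq_eq_sq₀ (by positivity) hp0.le, mul_pow, hκ, ← Real.exp_nat_mul, field]
    have : ((2 : ℕ) : ℝ) * (Real.log (p / (1 - p)) / 2) = Real.log (p / (1 - p)) := by
      push_cast; ring
    rw [this, Real.exp_log (by positivity)]
    field_simp
  refine ⟨h1, mul_left_cancel₀ hp0.ne' ?_⟩
  have h2 : Real.exp (field p) * Real.exp (-field p) = 1 := by rw [← Real.exp_add]; simp
  calc p * (√(p * (1 - p)) * Real.exp (-field p))
      = √(p * (1 - p)) * Real.exp (field p) * (√(p * (1 - p)) * Real.exp (-field p)) := by rw [h1]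
    _ = √(p * (1 - p)) ^ 2 * (Real.exp (field p) * Real.exp (-field p)) := by ring
    _ = p * (1 - p) := by rw [h2, hκ, mul_one]

/-- The linear recurrence given by the Cayley–Hamilton theorem for the transfer matrix. -/
theorem chainPartition_add_two (p t : ℝ) (L : ℕ) :
    chainPartition p t (L + 2) = Real.exp t * chainPartition p t (L + 1) -
      p * (1 - p) * (Real.exp t ^ 2 - Real.exp (-t) ^ 2) * chainPartition p t L := by
  simp only [chainPartition, chainWeight]
  ring

theorem chainPartition_eq {p : ℝ} (hp0 : 0 < p) (hp1 : p < 1) (t : ℝ) (L : ℕ) :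
    chainPartition p t L = √(p * (1 - p)) ^ (L + 1) *
      (eigPlus (field p) t ^ L * overlap (field p) t ^ 2 +
        eigMinus (field p) t ^ L * (2 * Real.cosh (field p) - overlap (field p) t ^ 2)) := by
  have hq : 0 < 1 - p := sub_pos.2 hp1
  have hκ := Real.sq_sqrt (mul_pos hp0 hq).le
  obtain ⟨h1, h2⟩ := sqrt_mul_exp_field hp0 hp1
  have hcosh : √(p * (1 - p)) * (2 * Real.cosh (field p)) = 1 := by
    rw [Real.cosh_eq]; linarith
  have hbond := eigPlus_mul_overlap_sq_add (field p) t
  have hsum := eigMinus_eq (field p) t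
  have hprod : eigPlus (field p) t * eigMinus (field p) t =
      Real.exp t ^ 2 - Real.exp (-t) ^ 2 := by
    have hchar := eigPlus_sub_mul_eigPlus_sub (field p) t
    have hee : Real.exp (field p) * Real.exp (-field p) = 1 := by rw [← Real.exp_add]; simp
    rw [Real.exp_add, sub_eq_add_neg t, Real.exp_add] at hchar
    rw [hsum, Real.cosh_eq]
    linear_combination (-1) * hchar + Real.exp t ^ 2 * hee
  rw [Real.exp_add, sub_eq_add_neg t, Real.exp_add] at hbond
  induction L using Nat.twoStepInduction with
  | zero =>
    rw [chainPartition_zero_right]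
    linear_combination (-1) * hcosh
  | one =>
    simp only [chainPartition, chainWeight, pow_one]
    rw [hbond]
    generalize √(p * (1 - p)) = κ at *
    generalize Real.exp (field p) = E at *
    generalize Real.exp (-field p) = m at *
    linear_combination (-Real.exp t * (κ * E + p)) * h1 - Real.exp t * (κ * m + (1 - p)) * h2 -
      2 * Real.exp (-t) * hκ
  | more L ih1 ih2 =>
    rw [chainPartition_add_two, ih1, ih2, ← hprod]
    have hexp : Real.exp t =
        √(p * (1 - p)) * (eigPlus (field p) t + eigMinus (field p) t) := by
      rw [hsum]; linear_combination (-Real.exp t) * hcosh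
    generalize √(p * (1 - p)) = κ at *
    rw [hexp, ← hκ]
    ring

theorem corrTerm_eq {p : ℝ} (hp0 : 0 < p) (hp1 : p < 1) (t : ℝ) (L : ℕ) :
    corrTerm (field p) t L = (Real.log (chainPartition p t L) -
      (L + 1) * Real.log √(p * (1 - p)) - L * Real.log (eigPlus (field p) t) -
      2 * Real.log (overlap (field p) t)) / 2 ^ L := by
  have hq : 0 < 1 - p := sub_pos.2 hp1
  have hκ : 0 < √(p * (1 - p)) := by positivity
  have hΛ := eigPlus_pos (field p) t
  have ha := overlap_pos (field p) t
  have hfac : chainPartition p t L = √(p * (1 - p)) ^ (L + 1) * eigPlus (field p) t ^ L *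
      overlap (field p) t ^ 2 * (1 + (2 * Real.cosh (field p) / overlap (field p) t ^ 2 - 1) *
        (eigMinus (field p) t / eigPlus (field p) t) ^ L) := by
    rw [chainPartition_eq hp0 hp1, div_pow]
    field_simp
  have hpos := chainPartition_pos hp0 hp1 t L
  rw [hfac] at hpos
  -- the bracket is positive because the partition function is, although `Λ₋` may be negative
  have hbr := pos_of_mul_pos_right hpos (by positivity)
  rw [hfac, Real.log_mul (by positivity) hbr.ne', Real.log_mul (by positivity) (by positivity),
    Real.log_mul (by positivity) (by positivity), Real.log_pow, Real.log_pow, Real.log_pow,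
    corrTerm]
  push_cast
  ring

theorem hasSum_corrTerm {p : ℝ} (hp0 : 0 < p) (hp1 : p < 1) (t : ℝ) :
    HasSum (fun n : ℕ => corrTerm (field p) t (n + 1))
      (2 * chainFreeEnergy p t - 3 * Real.log √(p * (1 - p)) -
        2 * Real.log (eigPlus (field p) t) - 2 * Real.log (overlap (field p) t)) := by
  have h1 := (summable_log_chainPartition hp0 hp1 t).hasSum.mul_left 2
  have h2 := (hasSum_succ_div_two_pow_succ.add hasSum_one_div_two_pow_succ).mul_left
    (Real.log √(p * (1 - p)))
  have h3 := hasSum_succ_div_two_pow_succ.mul_left (Real.log (eigPlus (field p) t))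
  have h4 := hasSum_one_div_two_pow_succ.mul_left (2 * Real.log (overlap (field p) t))
  have h := ((h1.sub h2).sub h3).sub h4
  rw [← chainFreeEnergy] at h
  convert! h using 1
  · ext n
    rw [corrTerm_eq hp0 hp1, pow_succ _ (n + 1)]
    push_cast
    field_simp
  · ring

theorem freeEnergy_eq_chainFreeEnergy {p : ℝ} (hp0 : 0 < p) (hp1 : p < 1) :
    freeEnergy p = chainFreeEnergy p := by
  ext t
  have hq : 0 < 1 - p := sub_pos.2 hp1
  have hpq : 0 < p * (1 - p) := by positivity
  have hΛ := eigPlus_pos (field p) t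
  have ha := overlap_pos (field p) t
  rw [freeEnergy, (hasSum_corrTerm hp0 hp1 t).tsum_eq, Real.log_mul (by positivity) hΛ.ne',
    Real.log_mul (by positivity) ha.ne', Real.log_rpow hpq, Real.log_sqrt hpq.le]
  ring

/-! ### Exponential moments of an i.i.d. chain -/

section Chain

theorem measurable_biSup_comap {Ω : Type*} (τ : ℕ → Ω → ℝ) {A : Set ℕ} {i : ℕ} (hi : i ∈ A) :
    Measurable[⨆ i ∈ A, MeasurableSpace.comap (τ i) inferInstance] (τ i) :=
  (comap_measurable (τ i)).mono
    (le_biSup (fun i => MeasurableSpace.comap (τ i) inferInstance) hi) le_rfl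

variable {Ω : Type*} [MeasurableSpace Ω] {P : Measure Ω}

/-- Functions of two disjoint subfamilies of an independent family are independent. -/
theorem indepFun_of_disjoint {τ : ℕ → Ω → ℝ} (hmeas : ∀ i, Measurable (τ i))
    (hindep : iIndepFun τ P) {A B : Set ℕ} (hAB : Disjoint A B) {f g : Ω → ℝ}
    (hf : Measurable[⨆ i ∈ A, MeasurableSpace.comap (τ i) inferInstance] f)
    (hg : Measurable[⨆ i ∈ B, MeasurableSpace.comap (τ i) inferInstance] g) :
    IndepFun f g P := by
  rw [IndepFun_iff_Indep]
  exact indep_of_indep_of_le_left (indep_of_indep_of_le_right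
    (indep_iSup_of_disjoint (fun i => (hmeas i).comap_le) hindep hAB) hg.comap_le) hf.comap_le

theorem integrable_exp_mul [IsFiniteMeasure P] {Y : Ω → ℝ} (hY : Measurable Y) {C : ℝ}
    (hb : ∀ᵐ ω ∂P, |Y ω| ≤ C) (t : ℝ) : Integrable (fun ω => Real.exp (t * Y ω)) P := by
  refine Integrable.of_bound (by fun_prop) (Real.exp (|t| * C)) ?_
  filter_upwards [hb] with ω hω
  rw [Real.norm_eq_abs, Real.abs_exp, Real.exp_le_exp]
  refine (le_abs_self _).trans ?_
  rw [abs_mul]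
  gcongr

theorem ae_eq_one_or_eq_neg_one [IsProbabilityMeasure P] {p : ℝ} (hp0 : 0 < p) (hp1 : p < 1)
    {X : Ω → ℝ} (hX : Measurable X) (hplus : P {ω | X ω = 1} = ENNReal.ofReal p)
    (hminus : P {ω | X ω = -1} = ENNReal.ofReal (1 - p)) : ∀ᵐ ω ∂P, X ω = 1 ∨ X ω = -1 := by
  have h1 : MeasurableSet {ω | X ω = 1} := hX (measurableSet_singleton 1)
  have h2 : MeasurableSet {ω | X ω = -1} := hX (measurableSet_singleton (-1))
  have hdisj : Disjoint {ω | X ω = 1} {ω | X ω = -1} :=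
    Set.disjoint_left.2 fun ω (ha : X ω = 1) (hb : X ω = -1) => by linarith
  have hmem : {ω | X ω = 1} ∪ {ω | X ω = -1} ∈ ae P := by
    rw [mem_ae_iff_prob_eq_one (h1.union h2), measure_union hdisj h2, hplus, hminus,
      ← ENNReal.ofReal_add hp0.le (by linarith)]
    simp
  exact hmem

theorem integral_indicator_singleton_comp {x q : ℝ} (hq : 0 ≤ q) {X : Ω → ℝ} (hX : Measurable X)
    (h : P {ω | X ω = x} = ENNReal.ofReal q) :
    ∫ ω, ({x} : Set ℝ).indicator (fun _ => (1 : ℝ)) (X ω) ∂P = q := by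
  have h1 : MeasurableSet {ω | X ω = x} := hX (measurableSet_singleton x)
  have h2 : (fun ω => ({x} : Set ℝ).indicator (fun _ => (1 : ℝ)) (X ω)) =
      {ω | X ω = x}.indicator fun _ => 1 := rfl
  rw [h2, integral_indicator_const _ h1, measureReal_def, h, ENNReal.toReal_ofReal hq, smul_eq_mul,
    mul_one]

variable [IsProbabilityMeasure P] {p : ℝ} {τ : ℕ → Ω → ℝ}

theorem ae_abs_pairSum_le (hp0 : 0 < p) (hp1 : p < 1) {σ : ℕ → Ω → ℝ}
    (hmeas : ∀ i, Measurable (σ i))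
    (hplus : ∀ i, P {ω | σ i ω = 1} = ENNReal.ofReal p)
    (hminus : ∀ i, P {ω | σ i ω = -1} = ENNReal.ofReal (1 - p)) (N : ℕ) :
    ∀ᵐ ω ∂P, |pairSum σ N ω| ≤ N := by
  have hall : ∀ᵐ ω ∂P, ∀ i, σ i ω = 1 ∨ σ i ω = -1 :=
    ae_all_iff.2 fun i => ae_eq_one_or_eq_neg_one hp0 hp1 (hmeas i) (hplus i) (hminus i)
  filter_upwards [hall] with ω hω
  refine (Finset.abs_sum_le_sum_abs _ _).trans ((Finset.sum_le_card_nsmul _ _ 1 ?_).trans_eq ?_)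
  · intro i _
    rcases hω i with h | h <;> rcases hω (2 * i) with h' | h' <;> simp [h, h']
  · simp

/-- The exponential moment of the energy of a chain, jointly with its last spin. The induction adds
the last bond of the chain and averages over the last spin. -/
theorem integral_exp_chain_mul (hp0 : 0 < p) (hp1 : p < 1) (hmeas : ∀ i, Measurable (τ i))
    (hindep : iIndepFun τ P) (hplus : ∀ i, P {ω | τ i ω = 1} = ENNReal.ofReal p)
    (hminus : ∀ i, P {ω | τ i ω = -1} = ENNReal.ofReal (1 - p)) (t : ℝ) (L : ℕ) (g : ℝ → ℝ)
    (hg : Measurable g) :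
    ∫ ω, Real.exp (t * ∑ j ∈ Finset.range L, τ j ω * τ (j + 1) ω) * g (τ L ω) ∂P =
      (chainWeight p t L).1 * g 1 + (chainWeight p t L).2 * g (-1) := by
  have hq : 0 < 1 - p := sub_pos.2 hp1
  set φ : ℝ → ℝ → ℝ := fun x => ({x} : Set ℝ).indicator fun _ => 1 with hφ
  have hφm : ∀ x, Measurable (φ x) := fun x =>
    measurable_const.indicator (measurableSet_singleton x)
  have hφ1 : ∀ i, ∫ ω, φ 1 (τ i ω) ∂P = p := fun i =>
    integral_indicator_singleton_comp hp0.le (hmeas i) (hplus i)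
  have hφ2 : ∀ i, ∫ ω, φ (-1) (τ i ω) ∂P = 1 - p := fun i =>
    integral_indicator_singleton_comp hq.le (hmeas i) (hminus i)
  have hφi : ∀ x i, Integrable (fun ω => φ x (τ i ω)) P := fun x i =>
    Integrable.of_bound ((hφm x).comp (hmeas i)).aestronglyMeasurable 1
      (Eventually.of_forall fun ω => by
        simp only [hφ, Set.indicator_apply]
        split_ifs <;> simp)
  have hsplit : ∀ i, ∀ᵐ ω ∂P, τ i ω = 1 ∧ φ 1 (τ i ω) = 1 ∧ φ (-1) (τ i ω) = 0 ∨
      τ i ω = -1 ∧ φ 1 (τ i ω) = 0 ∧ φ (-1) (τ i ω) = 1 := by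
    intro i
    filter_upwards [ae_eq_one_or_eq_neg_one hp0 hp1 (hmeas i) (hplus i) (hminus i)] with ω hω
    rcases hω with h | h
    · left; norm_num [hφ, h, Set.indicator_apply]
    · right; norm_num [hφ, h, Set.indicator_apply]
  induction L generalizing g with
  | zero =>
    have hae : (fun ω => Real.exp (t * ∑ j ∈ Finset.range 0, τ j ω * τ (j + 1) ω) * g (τ 0 ω))
        =ᵐ[P] fun ω => φ 1 (τ 0 ω) * g 1 + φ (-1) (τ 0 ω) * g (-1) := by
      filter_upwards [hsplit 0] with ω hω
      rcases hω with ⟨h, h1, h2⟩ | ⟨h, h1, h2⟩ <;> rw [h1, h2, h] <;> simp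
    rw [integral_congr_ae hae, integral_add ((hφi _ _).mul_const _) ((hφi _ _).mul_const _),
      integral_mul_const, integral_mul_const, hφ1, hφ2, chainWeight]
  | succ L ih =>
    -- the first `L` bonds, with a field `x` acting on their last spin
    set X : ℝ → Ω → ℝ := fun x ω =>
      Real.exp (t * ∑ j ∈ Finset.range L, τ j ω * τ (j + 1) ω) * Real.exp (t * x * τ L ω) with hX
    have hXmeas : ∀ x, Measurable[⨆ i ∈ Set.Iic L, MeasurableSpace.comap (τ i) inferInstance]
        (X x) := by
      intro x
      refine Measurable.mul (Measurable.exp ?_) (Measurable.exp ?_)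
      · refine Measurable.const_mul (Finset.measurable_fun_sum _ fun j hj => ?_) t
        have hj' : j < L := Finset.mem_range.1 hj
        exact (measurable_biSup_comap τ (Set.mem_Iic.2 hj'.le)).mul
          (measurable_biSup_comap τ (Set.mem_Iic.2 hj'))
      · exact Measurable.const_mul (measurable_biSup_comap τ (Set.mem_Iic.2 le_rfl)) _
    have hXint : ∀ x, ∫ ω, X x ω ∂P =
        (chainWeight p t L).1 * Real.exp (t * x) + (chainWeight p t L).2 * Real.exp (-(t * x)) := by
      intro x
      rw [hX, ih (fun y => Real.exp (t * x * y)) (by fun_prop)]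
      simp
    have hXi : ∀ x, Integrable (X x) P := by
      -- a non-integrable function would have integral zero
      intro x
      by_contra hni
      have h0 := hXint x
      rw [integral_undef hni] at h0
      obtain ⟨h1, h2⟩ := chainWeight_pos hp0 hp1 t L
      have : 0 < (chainWeight p t L).1 * Real.exp (t * x) +
        (chainWeight p t L).2 * Real.exp (-(t * x)) := by positivity
      linarith
    have hind : ∀ x y, IndepFun (X x) (fun ω => φ y (τ (L + 1) ω)) P := by
      intro x y
      refine indepFun_of_disjoint hmeas hindep (A := Set.Iic L) (B := {L + 1}) (by simp) (hXmeas x)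
        ((hφm y).comp (measurable_biSup_comap τ rfl))
    have hae : (fun ω => Real.exp (t * ∑ j ∈ Finset.range (L + 1), τ j ω * τ (j + 1) ω) *
        g (τ (L + 1) ω)) =ᵐ[P] fun ω => X 1 ω * φ 1 (τ (L + 1) ω) * g 1 +
          X (-1) ω * φ (-1) (τ (L + 1) ω) * g (-1) := by
      filter_upwards [hsplit (L + 1)] with ω hω
      rw [Finset.sum_range_succ, mul_add, Real.exp_add]
      rcases hω with ⟨h, h1, h2⟩ | ⟨h, h1, h2⟩ <;> rw [h1, h2, h] <;> simp [hX]
    have hmuli : ∀ x y, Integrable (fun ω => X x ω * φ y (τ (L + 1) ω)) P := fun x y =>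
      (hind x y).integrable_mul (hXi x) (hφi y (L + 1))
    rw [integral_congr_ae hae, integral_add ((hmuli _ _).mul_const _) ((hmuli _ _).mul_const _),
      integral_mul_const, integral_mul_const,
      (hind _ _).integral_fun_mul_eq_mul_integral (hXi _).aestronglyMeasurable
        (hφi _ _).aestronglyMeasurable,
      (hind _ _).integral_fun_mul_eq_mul_integral (hXi _).aestronglyMeasurable
        (hφi _ _).aestronglyMeasurable, hφ1, hφ2, hXint, hXint, chainWeight]
    simp only [mul_one, mul_neg, neg_neg]
    ring

theorem integral_exp_chain (hp0 : 0 < p) (hp1 : p < 1) (hmeas : ∀ i, Measurable (τ i))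
    (hindep : iIndepFun τ P) (hplus : ∀ i, P {ω | τ i ω = 1} = ENNReal.ofReal p)
    (hminus : ∀ i, P {ω | τ i ω = -1} = ENNReal.ofReal (1 - p)) (t : ℝ) (L : ℕ) :
    ∫ ω, Real.exp (t * ∑ j ∈ Finset.range L, τ j ω * τ (j + 1) ω) ∂P = chainPartition p t L := by
  simpa [chainPartition] using
    integral_exp_chain_mul hp0 hp1 hmeas hindep hplus hminus t L (fun _ => 1) measurable_const

end Chain

/-! ### Decomposition of the sum into chains -/

/-- The number of bonds `(r 2 ^ j, r 2 ^ (j + 1))` with `r 2 ^ j ≤ N`, for `1 ≤ r ≤ N`. -/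
def numBonds (N r : ℕ) : ℕ := Nat.log 2 (N / r) + 1

/-- The odd numbers up to `N`, the first elements of the maximal chains `r, 2 r, 4 r, …`. -/
def oddUpTo (N : ℕ) : Finset ℕ := {r ∈ Finset.Icc 1 N | Odd r}

theorem mem_oddUpTo {N r : ℕ} : r ∈ oddUpTo N ↔ r ≤ N ∧ Odd r := by
  simp only [oddUpTo, Finset.mem_filter, Finset.mem_Icc]
  exact ⟨fun h => ⟨h.1.2, h.2⟩, fun h => ⟨⟨h.2.pos, h.1⟩, h.2⟩⟩

theorem lt_numBonds_iff {N r j : ℕ} (hr : r ∈ oddUpTo N) : j < numBonds N r ↔ 2 ^ j * r ≤ N := by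
  obtain ⟨hrN, hodd⟩ := mem_oddUpTo.1 hr
  rw [numBonds, Nat.lt_succ_iff, Nat.le_log_iff_pow_le one_lt_two (Nat.div_pos hrN hodd.pos).ne',
    Nat.le_div_iff_mul_le hodd.pos]

theorem ordCompl_two_pow_mul {r : ℕ} (hr : Odd r) (j : ℕ) : ordCompl[2] (2 ^ j * r) = r :=
  Nat.ordCompl_pow_mul_of_not_dvd j Nat.prime_two hr.not_two_dvd_nat

theorem sum_Icc_eq_sum_chains {M : Type*} [AddCommMonoid M] (N : ℕ) (f : ℕ → M) :
    ∑ i ∈ Finset.Icc 1 N, f i =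
      ∑ r ∈ oddUpTo N, ∑ j ∈ Finset.range (numBonds N r), f (2 ^ j * r) := by
  rw [Finset.sum_sigma']
  refine Finset.sum_bij' (fun i _ => ⟨ordCompl[2] i, i.factorization 2⟩) (fun x _ => 2 ^ x.2 * x.1)
    ?_ ?_ ?_ ?_ ?_
  · intro i hi
    obtain ⟨hi1, hiN⟩ := Finset.mem_Icc.1 hi
    have hi0 : i ≠ 0 := by omega
    have hmem : ordCompl[2] i ∈ oddUpTo N := mem_oddUpTo.2 ⟨(Nat.ordCompl_le i 2).trans hiN,
      Nat.not_even_iff_odd.1 fun h => Nat.not_dvd_ordCompl Nat.prime_two hi0 h.two_dvd⟩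
    rw [Finset.mem_sigma]
    refine ⟨hmem, Finset.mem_range.2 ((lt_numBonds_iff hmem).2 ?_)⟩
    rwa [Nat.ordProj_mul_ordCompl_eq_self]
  · rintro ⟨r, j⟩ hx
    obtain ⟨hr, hj⟩ := Finset.mem_sigma.1 hx
    have hpos := (mem_oddUpTo.1 hr).2.pos
    exact Finset.mem_Icc.2 ⟨Nat.mul_pos (by positivity) hpos,
      (lt_numBonds_iff hr).1 (Finset.mem_range.1 hj)⟩
  · intro i _
    exact Nat.ordProj_mul_ordCompl_eq_self i 2
  · rintro ⟨r, j⟩ hx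
    obtain ⟨hr, hj⟩ := Finset.mem_sigma.1 hx
    have hodd := (mem_oddUpTo.1 hr).2
    have hfac : (2 ^ j * r).factorization 2 = j := by
      rw [Nat.factorization_mul (by positivity) hodd.pos.ne', Finsupp.add_apply,
        Nat.prime_two.factorization_pow, Finsupp.single_eq_same,
        Nat.factorization_eq_zero_of_not_dvd hodd.not_two_dvd_nat, add_zero]
    have h := ordCompl_two_pow_mul hodd j
    rw [hfac] at h
    simp only [hfac, h]
  · intro i _
    simp only [Nat.ordProj_mul_ordCompl_eq_self]

section Product

variable {Ω : Type*} [MeasurableSpace Ω] {P : Measure Ω} [IsProbabilityMeasure P] {p : ℝ}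
  {σ : ℕ → Ω → ℝ}

/-- Chains starting at different odd numbers are disjoint, so their exponential moments multiply. -/
theorem integral_prod_exp_chains (hp0 : 0 < p) (hp1 : p < 1) (hmeas : ∀ i, Measurable (σ i))
    (hindep : iIndepFun σ P) (hplus : ∀ i, P {ω | σ i ω = 1} = ENNReal.ofReal p)
    (hminus : ∀ i, P {ω | σ i ω = -1} = ENNReal.ofReal (1 - p)) (t : ℝ) (L : ℕ → ℕ) (R : Finset ℕ)
    (hR : ∀ r ∈ R, Odd r) :
    ∫ ω, ∏ r ∈ R, Real.exp
        (t * ∑ j ∈ Finset.range (L r), σ (2 ^ j * r) ω * σ (2 ^ (j + 1) * r) ω) ∂P =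
      ∏ r ∈ R, chainPartition p t (L r) := by
  induction R using Finset.induction_on with
  | empty => simp
  | insert a R ha ih =>
    have hchain : ∀ r, ∀ A : Set ℕ, (∀ j, 2 ^ j * r ∈ A) →
        Measurable[⨆ i ∈ A, MeasurableSpace.comap (σ i) inferInstance] fun ω => Real.exp
          (t * ∑ j ∈ Finset.range (L r), σ (2 ^ j * r) ω * σ (2 ^ (j + 1) * r) ω) :=
      fun r A hA => Measurable.exp (Measurable.const_mul (Finset.measurable_fun_sum _ fun j _ =>
        (measurable_biSup_comap σ (hA j)).mul (measurable_biSup_comap σ (hA (j + 1)))) t)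
    have hodd : Odd a := hR a (Finset.mem_insert_self a R)
    have hRodd : ∀ r ∈ R, Odd r := fun r hr => hR r (Finset.mem_insert_of_mem hr)
    have hfm := hchain a {i | ordCompl[2] i = a} fun j => ordCompl_two_pow_mul hodd j
    have hgm : Measurable[⨆ i ∈ {i : ℕ | ordCompl[2] i ∈ R},
        MeasurableSpace.comap (σ i) inferInstance] fun ω => ∏ r ∈ R, Real.exp
          (t * ∑ j ∈ Finset.range (L r), σ (2 ^ j * r) ω * σ (2 ^ (j + 1) * r) ω) :=
      Finset.measurable_fun_prod _ fun r hr => hchain r _ fun j => by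
        rw [Set.mem_ofPred_eq, ordCompl_two_pow_mul (hRodd r hr)]
        exact hr
    have hle : ∀ A : Set ℕ, (⨆ i ∈ A, MeasurableSpace.comap (σ i) inferInstance) ≤
        (inferInstance : MeasurableSpace Ω) := fun A => iSup₂_le fun i _ => (hmeas i).comap_le
    have hind := indepFun_of_disjoint hmeas hindep
      (Set.disjoint_left.2 fun i (hi : ordCompl[2] i = a) (hi' : ordCompl[2] i ∈ R) =>
        ha (hi ▸ hi')) hfm hgm
    have hmul : Function.Injective fun j : ℕ => 2 ^ j * a :=
      (mul_left_injective₀ hodd.pos.ne').comp (Nat.pow_right_injective le_rfl)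
    simp_rw [Finset.prod_insert ha]
    rw [hind.integral_fun_mul_eq_mul_integral (hfm.mono (hle _) le_rfl).aestronglyMeasurable
      (hgm.mono (hle _) le_rfl).aestronglyMeasurable, ih hRodd,
      integral_exp_chain hp0 hp1 (τ := fun j => σ (2 ^ j * a)) (fun j => hmeas _)
        (hindep.precomp hmul) (fun j => hplus _) fun j => hminus _]

theorem integral_exp_pairSum (hp0 : 0 < p) (hp1 : p < 1) (hmeas : ∀ i, Measurable (σ i))
    (hindep : iIndepFun σ P) (hplus : ∀ i, P {ω | σ i ω = 1} = ENNReal.ofReal p)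
    (hminus : ∀ i, P {ω | σ i ω = -1} = ENNReal.ofReal (1 - p)) (t : ℝ) (N : ℕ) :
    ∫ ω, Real.exp (t * pairSum σ N ω) ∂P = ∏ r ∈ oddUpTo N, chainPartition p t (numBonds N r) := by
  rw [← integral_prod_exp_chains hp0 hp1 hmeas hindep hplus hminus t (numBonds N) (oddUpTo N)
    fun r hr => (mem_oddUpTo.1 hr).2]
  congr 1 with ω
  rw [← Real.exp_sum, ← Finset.mul_sum, pairSum, sum_Icc_eq_sum_chains]
  simp_rw [pow_succ', mul_assoc]

end Product

/-! ### The density of chains of a given length -/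

theorem card_oddUpTo (M : ℕ) : (oddUpTo M).card = (M + 1) / 2 := by
  induction M with
  | zero => simp [oddUpTo]
  | succ M ih =>
    have hins : Finset.Icc 1 (M + 1) = insert (M + 1) (Finset.Icc 1 M) := by
      ext; simp only [Finset.mem_Icc, Finset.mem_insert]; omega
    rw [oddUpTo, hins, Finset.filter_insert]
    split_ifs with h
    · rw [Finset.card_insert_of_notMem (by simp), ← oddUpTo, ih]
      obtain ⟨k, hk⟩ := h
      omega
    · rw [← oddUpTo, ih]
      obtain ⟨k, hk⟩ := Nat.not_odd_iff_even.1 h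
      omega

theorem filter_log_eq (N n : ℕ) :
    {r ∈ oddUpTo N | Nat.log 2 (N / r) = n} = oddUpTo (N / 2 ^ n) \ oddUpTo (N / 2 ^ (n + 1)) := by
  ext r
  simp only [Finset.mem_filter, Finset.mem_sdiff]
  have key : ∀ m, r ∈ oddUpTo (N / 2 ^ m) ↔ r ∈ oddUpTo N ∧ m ≤ Nat.log 2 (N / r) := by
    intro m
    rw [mem_oddUpTo, Nat.le_div_iff_mul_le (by positivity), mul_comm]
    constructor
    · rintro ⟨h, hodd⟩
      have hr : r ∈ oddUpTo N :=
        mem_oddUpTo.2 ⟨(Nat.le_mul_of_pos_left r (by positivity)).trans h, hodd⟩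
      exact ⟨hr, Nat.lt_succ_iff.1 ((lt_numBonds_iff hr).2 h)⟩
    · rintro ⟨hr, h⟩
      exact ⟨(lt_numBonds_iff hr).1 (Nat.lt_succ_iff.2 h), (mem_oddUpTo.1 hr).2⟩
  rw [key, key]
  grind

theorem card_filter_log_eq (N n : ℕ) :
    ({r ∈ oddUpTo N | Nat.log 2 (N / r) = n}.card : ℝ) =
      ((N / 2 ^ n + 1) / 2 : ℕ) - ((N / 2 ^ (n + 1) + 1) / 2 : ℕ) := by
  have hsub : oddUpTo (N / 2 ^ (n + 1)) ⊆ oddUpTo (N / 2 ^ n) := fun r hr =>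
    mem_oddUpTo.2 ⟨(mem_oddUpTo.1 hr).1.trans
      (Nat.div_le_div_left (Nat.pow_le_pow_right two_pos n.le_succ) (by positivity)),
      (mem_oddUpTo.1 hr).2⟩
  rw [filter_log_eq, Finset.cast_card_sdiff hsub, card_oddUpTo, card_oddUpTo]

theorem abs_half_div_two_pow_sub_le (N n : ℕ) :
    |(((N / 2 ^ n + 1) / 2 : ℕ) : ℝ) - N / 2 ^ (n + 1)| ≤ 1 / 2 := by
  set m := N / 2 ^ n with hm
  set k := (m + 1) / 2 with hk
  have h2 : (0 : ℝ) < 2 ^ n := by positivity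
  have h1 : (m : ℝ) ≤ N / 2 ^ n := by
    rw [le_div_iff₀ h2]
    exact_mod_cast Nat.div_mul_le_self N (2 ^ n)
  have h3 : (N : ℝ) / 2 ^ n ≤ m + 1 := by
    rw [div_le_iff₀ h2]
    have := (Nat.lt_mul_of_div_lt (Nat.lt_succ_self m) (by positivity : 0 < 2 ^ n)).le
    have h' : (N : ℝ) ≤ ((m + 1) * 2 ^ n : ℕ) := Nat.cast_le.2 this
    push_cast at h'
    linarith
  have h4 : (m : ℝ) ≤ 2 * k := by exact_mod_cast (by omega : m ≤ 2 * k)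
  have h5 : (2 : ℝ) * k ≤ m + 1 := by exact_mod_cast (by omega : 2 * k ≤ m + 1)
  have h6 : (N : ℝ) / 2 ^ (n + 1) = N / 2 ^ n / 2 := by rw [pow_succ, div_div]
  rw [h6, abs_le]
  constructor <;> linarith

theorem tendsto_card_filter_log_eq (n : ℕ) :
    Tendsto (fun N : ℕ => ({r ∈ oddUpTo N | Nat.log 2 (N / r) = n}.card : ℝ) / N) atTop
      (𝓝 (1 / 2 ^ (n + 2))) := by
  rw [tendsto_iff_norm_sub_tendsto_zero]
  refine squeeze_zero' (Eventually.of_forall fun _ => norm_nonneg _) ?_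
    tendsto_one_div_atTop_nhds_zero_nat
  filter_upwards [eventually_gt_atTop 0] with N hN
  have hN' : (0 : ℝ) < N := by exact_mod_cast hN
  have h1 := abs_le.1 (abs_half_div_two_pow_sub_le N n)
  have h2 := abs_le.1 (abs_half_div_two_pow_sub_le N (n + 1))
  have h3 : (N : ℝ) / 2 ^ (n + 1) - N / 2 ^ (n + 2) = N / 2 ^ (n + 2) := by
    rw [pow_succ _ (n + 1)]; field_simp; norm_num
  have h4 : ({r ∈ oddUpTo N | Nat.log 2 (N / r) = n}.card : ℝ) / N - 1 / 2 ^ (n + 2) =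
      ({r ∈ oddUpTo N | Nat.log 2 (N / r) = n}.card - N / 2 ^ (n + 2)) / N := by
    field_simp
  rw [h4, card_filter_log_eq, norm_div, Real.norm_eq_abs, Real.norm_of_nonneg hN'.le]
  gcongr
  rw [abs_le]
  constructor <;> linarith [h1.1, h1.2, h2.1, h2.2]

theorem card_filter_log_eq_div_le (N n : ℕ) :
    ({r ∈ oddUpTo N | Nat.log 2 (N / r) = n}.card : ℝ) / N ≤ 1 / 2 ^ n := by
  rcases N.eq_zero_or_pos with rfl | hN
  · simp
  have hN' : (0 : ℝ) < N := by exact_mod_cast hN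
  have h1 : {r ∈ oddUpTo N | Nat.log 2 (N / r) = n}.card ≤ N / 2 ^ n := by
    rw [filter_log_eq]
    refine (Finset.card_le_card Finset.sdiff_subset).trans ?_
    rw [card_oddUpTo]
    generalize N / 2 ^ n = m
    omega
  rw [div_le_div_iff₀ hN' (by positivity), one_mul]
  exact_mod_cast (Nat.mul_le_mul_right (2 ^ n) h1).trans (Nat.div_mul_le_self N (2 ^ n))

/-- Averages over the chains converge, by dominated convergence over the number of bonds. -/
theorem tendsto_sum_numBonds {φ : ℕ → ℝ} {C : ℝ} (hφ : ∀ L : ℕ, |φ L| ≤ L * C) :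
    Tendsto (fun N : ℕ => 1 / (N : ℝ) * ∑ r ∈ oddUpTo N, φ (numBonds N r)) atTop
      (𝓝 (∑' n : ℕ, φ (n + 1) / 2 ^ (n + 2))) := by
  have hsum : ∀ N : ℕ, 1 / (N : ℝ) * ∑ r ∈ oddUpTo N, φ (numBonds N r) =
      ∑' n : ℕ, φ (n + 1) * (({r ∈ oddUpTo N | Nat.log 2 (N / r) = n}.card : ℝ) / N) := by
    intro N
    have hlog : ∀ r ∈ oddUpTo N, Nat.log 2 (N / r) ∈ Finset.range (N + 1) := fun r _ =>
      Finset.mem_range.2 (Nat.lt_succ_iff.2 ((Nat.log_le_self 2 _).trans (Nat.div_le_self N r)))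
    rw [tsum_eq_sum (s := Finset.range (N + 1)), ← Finset.sum_fiberwise_of_maps_to hlog,
      Finset.mul_sum]
    · refine Finset.sum_congr rfl fun n _ => ?_
      rw [Finset.sum_congr rfl fun r hr => by rw [numBonds, (Finset.mem_filter.1 hr).2],
        Finset.sum_const, nsmul_eq_mul]
      ring
    · intro n hn
      have hempty : {r ∈ oddUpTo N | Nat.log 2 (N / r) = n} = ∅ :=
        Finset.filter_eq_empty_iff.2 fun r hr h => hn (h ▸ hlog r hr)
      rw [hempty]
      simp
  simp_rw [hsum]
  refine tendsto_tsum_of_dominated_convergence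
    (bound := fun n : ℕ => 2 * C * (((n + 1 : ℕ) : ℝ) / 2 ^ (n + 1)))
    (hasSum_succ_div_two_pow_succ.summable.mul_left _) (fun n => ?_)
    (Eventually.of_forall fun N n => ?_)
  · rw [div_eq_mul_one_div]
    exact (tendsto_card_filter_log_eq n).const_mul _
  · rw [norm_mul, Real.norm_eq_abs, Real.norm_of_nonneg (by positivity)]
    calc _ ≤ ((n + 1 : ℕ) * C) * (1 / 2 ^ n) :=
          mul_le_mul (hφ _) (card_filter_log_eq_div_le N n) (by positivity)
            ((abs_nonneg _).trans (hφ _))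
      _ = _ := by rw [pow_succ]; field_simp

/-! ### The free energy of the sum -/

section FreeEnergy

variable {Ω : Type*} [MeasurableSpace Ω] {P : Measure Ω} [IsProbabilityMeasure P] {p : ℝ}
  {σ : ℕ → Ω → ℝ}

theorem tendsto_log_integral_exp_pairSum (hp0 : 0 < p) (hp1 : p < 1)
    (hmeas : ∀ i, Measurable (σ i))
    (hindep : iIndepFun σ P) (hplus : ∀ i, P {ω | σ i ω = 1} = ENNReal.ofReal p)
    (hminus : ∀ i, P {ω | σ i ω = -1} = ENNReal.ofReal (1 - p)) (t : ℝ) :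
    Tendsto (fun N : ℕ => 1 / (N : ℝ) * Real.log (∫ ω, Real.exp (t * pairSum σ N ω) ∂P)) atTop
      (𝓝 (freeEnergy p t)) := by
  rw [freeEnergy_eq_chainFreeEnergy hp0 hp1]
  have h := tendsto_sum_numBonds (φ := fun L => Real.log (chainPartition p t L))
    (abs_log_chainPartition_le hp0 hp1 t)
  refine h.congr fun N => ?_
  rw [integral_exp_pairSum hp0 hp1 hmeas hindep hplus hminus,
    Real.log_prod fun r _ => (chainPartition_pos hp0 hp1 t _).ne']

end FreeEnergy

end NonconventionalLDP

theorem theorem1 {Ω : Type*} [MeasurableSpace Ω] (P : Measure Ω) [IsProbabilityMeasure P]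
    (p : ℝ) (hp0 : 0 < p) (hp1 : p < 1)
    (σ : ℕ → Ω → ℝ) (hmeas : ∀ i, Measurable (σ i)) (hindep : iIndepFun σ P)
    (hplus : ∀ i, P {ω | σ i ω = 1} = ENNReal.ofReal p)
    (hminus : ∀ i, P {ω | σ i ω = -1} = ENNReal.ofReal (1 - p)) :
    (∀ t : ℝ, Summable (fun n : ℕ => NonconventionalLDP.corrTerm
        (NonconventionalLDP.field p) t (n + 1))) ∧
    (∀ t : ℝ, Tendsto (fun N : ℕ => 1 / (N : ℝ) *
        Real.log (∫ ω, Real.exp (t * NonconventionalLDP.pairSum σ N ω) ∂P))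
        atTop (𝓝 (NonconventionalLDP.freeEnergy p t))) ∧
    NonconventionalLDP.SatisfiesLDP P
      (fun N ω => NonconventionalLDP.pairSum σ N ω / (N : ℝ))
      (NonconventionalLDP.legendre (NonconventionalLDP.freeEnergy p)) ∧
    (p = 1 / 2 → ∀ t : ℝ, NonconventionalLDP.freeEnergy p t = Real.log (Real.cosh t)) := by
  open NonconventionalLDP in
  have hlim := tendsto_log_integral_exp_pairSum hp0 hp1 hmeas hindep hplus hminus
  have hbdd : ∀ N, ∀ᵐ ω ∂P, |pairSum σ N ω| ≤ N := 
    ae_abs_pairSum_le hp0 hp1 hmeas hplus hminus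
  have hSmeas : ∀ N, Measurable (pairSum σ N) := fun N =>
    Finset.measurable_fun_sum _ fun i _ => (hmeas i).mul (hmeas (2 * i))
  have hF := freeEnergy_eq_chainFreeEnergy hp0 hp1
  refine ⟨fun t => (hasSum_corrTerm hp0 hp1 t).summable, hlim, ?_, ?_⟩
  · refine satisfiesLDP_of_differentiable (fun N t => integrable_exp_mul (hSmeas N) (hbdd N) t)
      hSmeas hlim hbdd ?_ ?_
    · rw [hF]
      exact differentiable_chainFreeEnergy hp0 hp1
    · rw [hF, chainFreeEnergy_zero]
  · rintro rfl t
    rw [hF, chainFreeEnergy_half]
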